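/- Let $G=(V,E)$ be a finite graph with $V\neq\emptyset$, loops and multiple edges being allowed. For $A\subseteq E$ let $c(A)$ be the number of connected components of the spanning subgraph $(V,A)$ and $r(A)=|V|-c(A)$, and let $$T_G(x,y)=\sum_{A\subseteq E}(x-1)^{r(E)-r(A)}(y-1)^{|A|-r(A)}$$ be the Tutte polynomial of $G$. Let $k\ge 0$ be an integer; if $k=1$, assume in addition that $G$ is connected or that no two distinct edges of $G$ join the same pair of distinct vertices. Then the coefficient of $y^i$ in $T_G(1,y)$ equals $$\binom{|E|-i-1}{|E|-|V|+1-i}$$ for all integers $i$ with $|E|-|V|+2-k\le i\le |E|-|V|+1$ if and only if $G$ is $k$-edge-connected, that is, $G-F$ is connected for every $F\subseteq E$ with $|F|<k$. Here the coefficient of $y^i$ is understood to be $0$ for $i<0$, and $\binom{a}{j}=a(a-1)\cdots(a-j+1)/j!$ for all integers $a$ and $j\ge0$ (so $\binom{a}{0}=1$, also for $a=-1$). -/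

import Mathlib

open Polynomial

noncomputable section

namespace Graph

/-- A (multi)graph is connected if it has a vertex and any two of its vertices are joined by
a path. -/
def IsConnected {α β : Type*} (G : Graph α β) : Prop :=
  G.vertexSet.Nonempty ∧
    ∀ u ∈ G.vertexSet, ∀ v ∈ G.vertexSet, Relation.ReflTransGen G.Adj u v

/-- `G` is `k`-edge-connected if it stays connected after the deletion of any fewer than `k`
edges. -/
def IsEdgeConnected {α β : Type*} (G : Graph α β) (k : ℕ) : Prop :=
  ∀ F : Set β, F ⊆ G.edgeSet → F.encard < (k : ℕ∞) → (G.deleteEdges F).IsConnected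

/-- No two distinct edges of `G` join the same two distinct vertices (loops are not
restricted). -/
def NoParallelEdges {α β : Type*} (G : Graph α β) : Prop :=
  ∀ (e f : β) (u v : α), u ≠ v → G.IsLink e u v → G.IsLink f u v → e = f

/-- The number of connected components: `Quot` identifies the vertices that are related by the
equivalence relation generated by adjacency. -/
def numComponents {α β : Type*} (G : Graph α β) : ℕ :=
  Nat.card (Quot fun u v : G.vertexSet => G.Adj (u : α) (v : α))

/-- The rank `r(A) = |V| - c(A)` of a set `A` of edges, where `c(A)` is the number of connected
components of the spanning subgraph `(V, A)`. -/
def edgeRank {α β : Type*} (G : Graph α β) (A : Set β) : ℕ :=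
  G.vertexSet.ncard - (G.restrict A).numComponents

/-- The Tutte polynomial
`T_G(x, y) = ∑_{A ⊆ E} (x - 1) ^ (r(E) - r(A)) * (y - 1) ^ (|A| - r(A))` of a finite graph,
as a polynomial in `y` (the outer variable) over the polynomials in `x` (the inner variable). -/
def tuttePolynomial {α β : Type*} (G : Graph α β) : ℤ[X][X] :=
  ∑ᶠ A ∈ G.edgeSet.powerset,
    (C (X : ℤ[X]) - 1) ^ (G.edgeRank G.edgeSet - G.edgeRank A) *
      (X - 1) ^ (A.ncard - G.edgeRank A)

/-- The univariate polynomial `T_G(1, y)`. -/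
def tutteAtOne {α β : Type*} (G : Graph α β) : ℤ[X] :=
  G.tuttePolynomial.map (evalRingHom (1 : ℤ))

end Graph

/-- The coefficient of `y ^ i` in a polynomial, for an integer `i`; it is `0` for `i < 0`. -/
def intCoeff (p : ℤ[X]) (i : ℤ) : ℤ :=
  if 0 ≤ i then p.coeff i.toNat else 0

end

/-! At `x = 1` only spanning edge sets (those of full rank) survive in the Tutte sum, and reversing
the coefficients of `T_G(1, y)` gives `dualHPoly`, with coefficients `h_s`; `h_s` belongs to `y ^
(|E| - r(E) - s)` (`intCoeff_tutteAtOne`).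

If `G` is connected, `r = r(E) = |V| - 1` and the prescribed binomials are the coefficients of `(1 -
X) ^ (-r)`. The sum of `X ^ (|E| - |A|) * (1 - X) ^ |A|` over all `A` is `1`, so `(1 - X) ^ r * h`
is `1` minus the part over non-spanning `A`. Its terms of lowest order cannot cancel, hence the
first `k` coefficients agree iff every non-spanning set misses at least `k` edges, which is
`k`-edge-connectedness (`coeff_dualHPoly_eq_coeff_invOneSubPow_iff`).

If `G` has `c + 2` components, the index is shifted by `c + 1`, and the conditions for `j = 0, 1`
read `h_{c+1} = 1` and `h_{c+2} = |V| - 1`. Deletion-contraction shows that no `h_s` with `s > 0` is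
`1` when there are no parallel elements (`coeff_dualHPoly_ne_one_of_simple`, for `k = 1`), and that
in general `h_s = 1` with `s > 0` forces `h_{s+1} ≤ 1` (`coeff_dualHPoly_succ_le_one`, for `k ≥ 2`).
In the latter case `|V| ≤ 2`, so all edges are loops and `h_{c+1} = 0`, a contradiction. -/

/-! ### Matroid rank functions and contraction. -/

/-- The rank axioms of a matroid, for a rank function on finite sets. -/
structure IsMatroidRank {β : Type*} [DecidableEq β] (r : Finset β → ℕ) : Prop where
  empty : r ∅ = 0
  le_insert : ∀ e A, r A ≤ r (insert e A)
  insert_le : ∀ e A, r (insert e A) ≤ r A + 1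
  insert_eq_of_subset : ∀ e A B, A ⊆ B → r (insert e A) = r A → r (insert e B) = r B

/-- The rank function of the contraction of `e`. -/
def contractRank {β : Type*} [DecidableEq β] (r : Finset β → ℕ) (e : β) (A : Finset β) : ℕ :=
  r (insert e A) - r {e}

/-- The `h`-polynomial of the independence complex of the dual matroid, as a sum over the
spanning sets. -/
noncomputable def dualHPoly {β : Type*} (r : Finset β → ℕ) (E : Finset β) : ℤ[X] :=
  ∑ A ∈ E.powerset,
    if r A = r E then X ^ (E.card - A.card) * (1 - X) ^ (A.card - r E) else 0

/-- The number of elements of positive rank minus the rank: the degree of `dualHPoly r E`. -/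
def looplessNullity {β : Type*} (r : Finset β → ℕ) (E : Finset β) : ℕ :=
  (E.filter fun e => r {e} ≠ 0).card - r E

namespace IsMatroidRank

variable {β : Type*} [DecidableEq β] {r : Finset β → ℕ}

theorem mono (hr : IsMatroidRank r) {A B : Finset β} (h : A ⊆ B) : r A ≤ r B := by
  rw [← Finset.sdiff_union_of_subset h]
  induction B \ A using Finset.induction_on with
  | empty => simp
  | insert e C _ ih => exact ih.trans (by rw [Finset.insert_union]; exact hr.le_insert _ _)

theorem singleton_le_one (hr : IsMatroidRank r) (e : β) : r {e} ≤ 1 := by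
  have := hr.insert_le e ∅
  rwa [hr.empty, insert_empty_eq] at this

theorem insert_of_loop (hr : IsMatroidRank r) {e : β} (he : r {e} = 0) (A : Finset β) :
    r (insert e A) = r A :=
  hr.insert_eq_of_subset e ∅ A (Finset.empty_subset A) (by rw [insert_empty_eq, he, hr.empty])

theorem insert_of_subset_of_coloop (hr : IsMatroidRank r) {e : β} {A E : Finset β} (hA : A ⊆ E)
    (he : r (insert e E) = r E + 1) : r (insert e A) = r A + 1 := by
  have h1 := hr.insert_le e A
  have h2 := hr.le_insert e A
  have h3 := hr.insert_eq_of_subset e A E hA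
  by_contra h
  have := h3 (by omega)
  omega

theorem le_card (hr : IsMatroidRank r) (A : Finset β) : r A ≤ A.card := by
  induction A using Finset.induction_on with
  | empty => simp [hr.empty]
  | insert e A he ih =>
    rw [Finset.card_insert_of_notMem he]
    exact (hr.insert_le e A).trans (by omega)

theorem le_card_nonloops (hr : IsMatroidRank r) (E : Finset β) :
    r E ≤ (E.filter fun e => r {e} ≠ 0).card := by
  induction E using Finset.induction_on with
  | empty => simp [hr.empty]
  | insert e E he ih =>
    by_cases h : r {e} = 0
    · rwa [hr.insert_of_loop h, Finset.filter_insert, if_neg (not_not.2 h)]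
    · rw [Finset.filter_insert, if_pos h, Finset.card_insert_of_notMem (by simp [he])]
      exact (hr.insert_le e E).trans (by omega)

theorem contract (hr : IsMatroidRank r) (e : β) : IsMatroidRank (contractRank r e) where
  empty := by simp [contractRank]
  le_insert f A := by
    have := hr.le_insert f (insert e A)
    simp only [contractRank, Finset.insert_comm e f]
    omega
  insert_le f A := by
    have := hr.insert_le f (insert e A)
    simp only [contractRank, Finset.insert_comm e f]
    omega
  insert_eq_of_subset f A B h h1 := by
    simp only [contractRank, Finset.insert_comm e f] at h1 ⊢
    have h2 : ∀ C, r {e} ≤ r (insert e C) := fun C => hr.mono (by simp)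
    have h3 := h2 A
    have h4 := hr.le_insert f (insert e A)
    rw [hr.insert_eq_of_subset f (insert e A) (insert e B) (Finset.insert_subset_insert e h)
      (by omega)]

end IsMatroidRank

/-! ### Deletion-contraction for the dual `h`-polynomial and its degree. -/

section dualHPoly

variable {β : Type*} {r : Finset β → ℕ}

theorem dualHPoly_congr {r' : Finset β → ℕ} {E : Finset β} (h : ∀ A ⊆ E, r A = r' A) :
    dualHPoly r E = dualHPoly r' E := by
  refine Finset.sum_congr rfl fun A hA => ?_
  rw [h A (Finset.mem_powerset.1 hA), h E subset_rfl]

variable [DecidableEq β]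

theorem dualHPoly_insert {e : β} {E : Finset β} (he : e ∉ E) :
    dualHPoly r (insert e E) =
      (∑ A ∈ E.powerset, if r A = r (insert e E) then
        X ^ (E.card + 1 - A.card) * (1 - X) ^ (A.card - r (insert e E)) else 0) +
      ∑ A ∈ E.powerset, if r (insert e A) = r (insert e E) then
        X ^ (E.card - A.card) * (1 - X) ^ (A.card + 1 - r (insert e E)) else 0 := by
  rw [dualHPoly, Finset.sum_powerset_insert he, Finset.card_insert_of_notMem he]
  congr 1
  refine Finset.sum_congr rfl fun A hA => ?_
  rw [Finset.card_insert_of_notMem fun h => he (Finset.mem_powerset.1 hA h), Nat.add_sub_add_right]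

theorem dualHPoly_insert_of_loop (hr : IsMatroidRank r) {e : β} {E : Finset β} (he : e ∉ E)
    (h : r {e} = 0) : dualHPoly r (insert e E) = dualHPoly r E := by
  rw [dualHPoly_insert he, dualHPoly, ← Finset.sum_add_distrib]
  refine Finset.sum_congr rfl fun A hA => ?_
  have h1 := Finset.card_le_card (Finset.mem_powerset.1 hA)
  have h2 := hr.le_card A
  rw [hr.insert_of_loop h, hr.insert_of_loop h]
  split_ifs with h3
  · rw [Nat.sub_add_comm h1, Nat.sub_add_comm (by omega)]
    ring
  · simp

theorem dualHPoly_insert_of_coloop (hr : IsMatroidRank r) {e : β} {E : Finset β} (he : e ∉ E)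
    (h : r (insert e E) = r E + 1) : dualHPoly r (insert e E) = dualHPoly r E := by
  rw [dualHPoly_insert he, dualHPoly, ← Finset.sum_add_distrib]
  refine Finset.sum_congr rfl fun A hA => ?_
  have hA := Finset.mem_powerset.1 hA
  have h1 := hr.mono hA
  rw [hr.insert_of_subset_of_coloop hA h, h, if_neg (by omega), zero_add]
  simp only [Nat.add_right_cancel_iff, Nat.add_sub_add_right]

theorem dualHPoly_contract_of_coloop (hr : IsMatroidRank r) {e : β} {E : Finset β}
    (h : r (insert e E) = r E + 1) : dualHPoly (contractRank r e) E = dualHPoly r E := by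
  refine dualHPoly_congr fun A hA => ?_
  have h1 := hr.insert_of_subset_of_coloop (Finset.empty_subset E) h
  rw [contractRank, hr.insert_of_subset_of_coloop hA h, ← insert_empty_eq, h1, hr.empty]
  omega

theorem dualHPoly_insert_of_nonloop (hr : IsMatroidRank r) {e : β} {E : Finset β} (he : e ∉ E)
    (h : r {e} ≠ 0) (h' : r (insert e E) = r E) :
    dualHPoly r (insert e E) = X * dualHPoly r E + dualHPoly (contractRank r e) E := by
  rw [dualHPoly_insert he, dualHPoly, dualHPoly, Finset.mul_sum]
  have h1 := hr.singleton_le_one e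
  have h2 : ∀ A, r {e} ≤ r (insert e A) := fun A => hr.mono (by simp)
  congr 1
  · refine Finset.sum_congr rfl fun A hA => ?_
    have h3 := Finset.card_le_card (Finset.mem_powerset.1 hA)
    rw [h']
    split_ifs
    · rw [Nat.sub_add_comm h3]
      ring
    · simp
  · refine Finset.sum_congr rfl fun A hA => ?_
    have h3 := h2 A
    have h4 := h2 E
    rw [contractRank, contractRank]
    refine if_congr (by omega) ?_ rfl
    congr 2
    omega

theorem looplessNullity_insert_of_loop (hr : IsMatroidRank r) {e : β} (E : Finset β)
    (h : r {e} = 0) : looplessNullity r (insert e E) = looplessNullity r E := by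
  rw [looplessNullity, looplessNullity, hr.insert_of_loop h, Finset.filter_insert,
    if_neg (not_not.2 h)]

theorem looplessNullity_insert_of_coloop (hr : IsMatroidRank r) {e : β} {E : Finset β}
    (he : e ∉ E) (h : r (insert e E) = r E + 1) :
    looplessNullity r (insert e E) = looplessNullity r E := by
  have h1 : r {e} ≠ 0 := fun h1 => by have := hr.insert_of_loop h1 E; omega
  rw [looplessNullity, looplessNullity, h, Finset.filter_insert, if_pos h1,
    Finset.card_insert_of_notMem (by simp [he]), Nat.add_sub_add_right]

theorem looplessNullity_insert_of_nonloop (hr : IsMatroidRank r) {e : β} {E : Finset β}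
    (he : e ∉ E) (h : r {e} ≠ 0) (h' : r (insert e E) = r E) :
    looplessNullity r (insert e E) = looplessNullity r E + 1 := by
  have := hr.le_card_nonloops E
  rw [looplessNullity, looplessNullity, h', Finset.filter_insert, if_pos h,
    Finset.card_insert_of_notMem (by simp [he]), Nat.sub_add_comm this]

/-- Contraction lowers the rank by exactly one and the number of non-loops by at least one: `e` is
gone, and elements parallel to `e` become loops. -/
theorem looplessNullity_contract_le (hr : IsMatroidRank r) {e : β} {E : Finset β}
    (he : e ∉ E) (h : r {e} ≠ 0) :
    looplessNullity (contractRank r e) E ≤ looplessNullity r (insert e E) := by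
  have h1 := hr.singleton_le_one e
  have h2 : (E.filter fun f => contractRank r e {f} ≠ 0).card ≤
      (E.filter fun f => r {f} ≠ 0).card := by
    refine Finset.card_le_card fun f hf => ?_
    rw [Finset.mem_filter] at hf ⊢
    refine ⟨hf.1, fun h3 => hf.2 ?_⟩
    rw [contractRank, Finset.pair_comm, hr.insert_of_loop h3, Nat.sub_self]
  rw [looplessNullity, looplessNullity, Finset.filter_insert, if_pos h,
    Finset.card_insert_of_notMem (by simp [he])]
  have h3 : contractRank r e E = r (insert e E) - r {e} := rfl
  omega

theorem looplessNullity_contract_of_simple (hr : IsMatroidRank r) {e : β} {E : Finset β}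
    (he : e ∉ E) (h : r {e} ≠ 0) (hs : ∀ f ∈ E, r {f} ≠ 0 → r {e, f} ≠ r {e}) :
    looplessNullity (contractRank r e) E = looplessNullity r (insert e E) := by
  refine (looplessNullity_contract_le hr he h).antisymm ?_
  have h1 := hr.singleton_le_one e
  have h4 : r {e} ≤ r (insert e E) := hr.mono (by simp)
  have h2 : (E.filter fun f => r {f} ≠ 0).card ≤
      (E.filter fun f => contractRank r e {f} ≠ 0).card := by
    refine Finset.card_le_card fun f hf => ?_
    rw [Finset.mem_filter] at hf ⊢
    refine ⟨hf.1, ?_⟩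
    have h3 := hs f hf.1 hf.2
    have : r {e} ≤ r {e, f} := hr.mono (by simp)
    rw [contractRank]
    omega
  rw [looplessNullity, looplessNullity, Finset.filter_insert, if_pos h,
    Finset.card_insert_of_notMem (by simp [he])]
  have h3 : contractRank r e E = r (insert e E) - r {e} := rfl
  omega

/-- Every element is a loop, a coloop, or neither. -/
theorem IsMatroidRank.insert_cases (hr : IsMatroidRank r) (e : β) (E : Finset β) :
    r {e} = 0 ∨ r (insert e E) = r E + 1 ∨ r {e} ≠ 0 ∧ r (insert e E) = r E := by
  have := hr.le_insert e E
  have := hr.insert_le e E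
  omega

/-! ### Positivity and monotonicity of the coefficients, and coefficients equal to one. -/

theorem dualHPoly_empty (hr : IsMatroidRank r) : dualHPoly r ∅ = 1 := by
  simp [dualHPoly, hr.empty]

theorem coeff_dualHPoly_pos_and_eq_zero (hr : IsMatroidRank r) (E : Finset β) (j : ℕ) :
    (j ≤ looplessNullity r E → 0 < (dualHPoly r E).coeff j) ∧
      (looplessNullity r E < j → (dualHPoly r E).coeff j = 0) := by
  induction E using Finset.induction_on generalizing r j with
  | empty =>
    have h0 : looplessNullity r ∅ = 0 := by simp [looplessNullity]
    rw [dualHPoly_empty hr, h0, coeff_one]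
    constructor <;> intro h
    · simp [Nat.le_zero.1 h]
    · rw [if_neg (by omega)]
  | insert e E he ih =>
    rcases hr.insert_cases e E with h | h | ⟨h, h'⟩
    · rw [dualHPoly_insert_of_loop hr he h, looplessNullity_insert_of_loop hr E h]
      exact ih hr j
    · rw [dualHPoly_insert_of_coloop hr he h, looplessNullity_insert_of_coloop hr he h]
      exact ih hr j
    · have h1 := looplessNullity_contract_le hr he h
      have h2 := ih (hr.contract e) j
      rw [dualHPoly_insert_of_nonloop hr he h h', coeff_add]
      rw [looplessNullity_insert_of_nonloop hr he h h'] at h1 ⊢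
      cases j with
      | zero =>
        rw [coeff_X_mul_zero, zero_add]
        exact ⟨fun _ => h2.1 (Nat.zero_le _), fun h => absurd h (by omega)⟩
      | succ j =>
        have h3 := ih hr j
        rw [coeff_X_mul]
        refine ⟨fun h4 => ?_, fun h4 => ?_⟩
        · have h5 := h3.1 (by omega)
          rcases le_or_gt (j + 1) (looplessNullity (contractRank r e) E) with h6 | h6
          · have := h2.1 h6
            omega
          · have := h2.2 h6
            omega
        · rw [h3.2 (by omega), h2.2 (by omega), add_zero]

theorem coeff_dualHPoly_pos (hr : IsMatroidRank r) {E : Finset β} {j : ℕ}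
    (h : j ≤ looplessNullity r E) : 0 < (dualHPoly r E).coeff j :=
  (coeff_dualHPoly_pos_and_eq_zero hr E j).1 h

theorem coeff_dualHPoly_eq_zero (hr : IsMatroidRank r) {E : Finset β} {j : ℕ}
    (h : looplessNullity r E < j) : (dualHPoly r E).coeff j = 0 :=
  (coeff_dualHPoly_pos_and_eq_zero hr E j).2 h

theorem coeff_dualHPoly_nonneg (hr : IsMatroidRank r) (E : Finset β) (j : ℕ) :
    0 ≤ (dualHPoly r E).coeff j := by
  rcases le_or_gt j (looplessNullity r E) with h | h
  · exact (coeff_dualHPoly_pos hr h).le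
  · exact (coeff_dualHPoly_eq_zero hr h).ge

theorem coeff_dualHPoly_le_insert (hr : IsMatroidRank r) {e : β} {E : Finset β} (he : e ∉ E)
    (j : ℕ) : (dualHPoly r E).coeff j ≤ (dualHPoly r (insert e E)).coeff j := by
  induction E using Finset.induction_on generalizing r j with
  | empty =>
    rcases hr.insert_cases e ∅ with h | h | ⟨h, h'⟩
    · rw [dualHPoly_insert_of_loop hr he h]
    · rw [dualHPoly_insert_of_coloop hr he h]
    · exact absurd h' (by simp [hr.empty, h])
  | insert f E hf ih =>
    have heE : e ∉ E := fun h => he (Finset.mem_insert_of_mem h)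
    have hfe : f ∉ insert e E := by
      rw [Finset.mem_insert, not_or]
      exact ⟨fun h => he (by simp [h]), hf⟩
    rw [Finset.insert_comm e f]
    rcases hr.insert_cases f E with h | h | ⟨h, h'⟩
    · rw [dualHPoly_insert_of_loop hr hf h, dualHPoly_insert_of_loop hr hfe h]
      exact ih hr heE j
    · rw [dualHPoly_insert_of_coloop hr hf h]
      rcases hr.insert_cases f (insert e E) with g | g | ⟨g, g'⟩
      · rw [dualHPoly_insert_of_loop hr hfe g]
        exact ih hr heE j
      · rw [dualHPoly_insert_of_coloop hr hfe g]
        exact ih hr heE j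
      -- A coloop `f` can stop being one once `e` is added. For a coloop, deletion and contraction
      -- have the same polynomial, so the contraction term alone already suffices.
      · rw [dualHPoly_insert_of_nonloop hr hfe g g', coeff_add,
          ← dualHPoly_contract_of_coloop hr h]
        have h1 := ih (hr.contract f) heE j
        cases j with
        | zero => rwa [coeff_X_mul_zero, zero_add]
        | succ j =>
          have := coeff_dualHPoly_nonneg hr (insert e E) j
          rw [coeff_X_mul]
          omega
    · have g := hr.insert_eq_of_subset f E (insert e E) (Finset.subset_insert e E) h'
      rw [dualHPoly_insert_of_nonloop hr hf h h', dualHPoly_insert_of_nonloop hr hfe h g,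
        coeff_add, coeff_add]
      refine add_le_add ?_ (ih (hr.contract f) heE j)
      cases j with
      | zero => simp
      | succ j =>
        rw [coeff_X_mul, coeff_X_mul]
        exact ih hr heE j

/-- In `h_{j+1} = h_j(E) + h_{j+1}(E / e)` the deletion term is already at least `1`, so the
contraction term vanishes and its degree is too small. -/
theorem looplessNullity_contract_lt_of_coeff_eq_one (hr : IsMatroidRank r) {e : β}
    {E : Finset β} (he : e ∉ E) (h : r {e} ≠ 0) (h' : r (insert e E) = r E) {j : ℕ}
    (hj : (dualHPoly r (insert e E)).coeff (j + 1) = 1) :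
    j + 1 ≤ looplessNullity r (insert e E) ∧
      looplessNullity (contractRank r e) E < j + 1 := by
  have h1 : j + 1 ≤ looplessNullity r (insert e E) := by
    by_contra h1
    rw [coeff_dualHPoly_eq_zero hr (not_le.1 h1)] at hj
    omega
  refine ⟨h1, ?_⟩
  rw [looplessNullity_insert_of_nonloop hr he h h'] at h1
  rw [dualHPoly_insert_of_nonloop hr he h h', coeff_add, coeff_X_mul] at hj
  by_contra h2
  have h3 := coeff_dualHPoly_pos hr (E := E) (j := j) (by omega)
  have h4 := coeff_dualHPoly_pos (hr.contract e) (not_lt.1 h2)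
  omega

theorem coeff_dualHPoly_succ_le_one (hr : IsMatroidRank r) {E : Finset β} {j : ℕ}
    (hj : (dualHPoly r E).coeff (j + 1) = 1) : (dualHPoly r E).coeff (j + 2) ≤ 1 := by
  induction E using Finset.induction_on with
  | empty => simp [dualHPoly_empty hr, coeff_one] at hj
  | insert e E he ih =>
    rcases hr.insert_cases e E with h | h | ⟨h, h'⟩
    · rw [dualHPoly_insert_of_loop hr he h] at hj ⊢
      exact ih hj
    · rw [dualHPoly_insert_of_coloop hr he h] at hj ⊢
      exact ih hj
    · have h1 := (looplessNullity_contract_lt_of_coeff_eq_one hr he h h' hj).2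
      rw [dualHPoly_insert_of_nonloop hr he h h', coeff_add, coeff_X_mul,
        coeff_dualHPoly_eq_zero (hr.contract e) (by omega), add_zero, ← hj]
      exact coeff_dualHPoly_le_insert hr he _

theorem coeff_dualHPoly_ne_one_of_simple (hr : IsMatroidRank r) {E : Finset β}
    (hs : ∀ e ∈ E, ∀ f ∈ E, e ≠ f → r {e} ≠ 0 → r {f} ≠ 0 → r {e, f} ≠ r {e}) (j : ℕ) :
    (dualHPoly r E).coeff (j + 1) ≠ 1 := by
  induction E using Finset.induction_on with
  | empty => simp [dualHPoly_empty hr, coeff_one]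
  | insert e E he ih =>
    have ih' := ih fun a ha b hb =>
      hs a (Finset.mem_insert_of_mem ha) b (Finset.mem_insert_of_mem hb)
    rcases hr.insert_cases e E with h | h | ⟨h, h'⟩
    · rwa [dualHPoly_insert_of_loop hr he h]
    · rwa [dualHPoly_insert_of_coloop hr he h]
    · intro hj
      have h1 := looplessNullity_contract_lt_of_coeff_eq_one hr he h h' hj
      -- Without elements parallel to `e`, contraction keeps the degree, so the two bounds in `h1`
      -- clash.
      rw [looplessNullity_contract_of_simple hr he h fun f hf =>
        hs e (Finset.mem_insert_self e E) f (Finset.mem_insert_of_mem hf)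
          (fun hef => he (hef ▸ hf)) h] at h1
      omega

end dualHPoly

/-! ### The number of classes after relating one more pair. -/

theorem Quot.mk_eq_of_le {V : Type*} {R R' : V → V → Prop} (h : ∀ x y, R x y → R' x y) {x y : V}
    (hxy : Quot.mk R x = Quot.mk R y) : Quot.mk R' x = Quot.mk R' y :=
  Quot.eqvGen_sound ((Quot.eqvGen_exact hxy).mono h)

theorem Nat.card_quot_of_adjoin_related {V : Type*} {R R' : V → V → Prop} {u v : V}
    (h : ∀ x y, R' x y ↔ R x y ∨ (x = u ∧ y = v) ∨ (x = v ∧ y = u))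
    (huv : Quot.mk R u = Quot.mk R v) : Nat.card (Quot R') = Nat.card (Quot R) := by
  refine (Nat.card_congr (Equiv.ofBijective
    (Quot.map id fun x y hxy => (h x y).2 (Or.inl hxy) : Quot R → Quot R') ⟨?_, ?_⟩)).symm
  · rintro ⟨x⟩ ⟨y⟩ hxy
    have hxy : Quot.mk R' x = Quot.mk R' y := hxy
    have h1 := Quot.eqvGen_exact hxy
    change Quot.mk R x = Quot.mk R y
    clear * - h1 h huv
    induction h1 with
    | rel x y hxy =>
      rcases (h x y).1 hxy with h2 | ⟨rfl, rfl⟩ | ⟨rfl, rfl⟩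
      · exact Quot.sound h2
      · exact huv
      · exact huv.symm
    | refl => rfl
    | symm x y _ ih => exact ih.symm
    | trans x y z _ _ ih1 ih2 => exact ih1.trans ih2
  · rintro ⟨x⟩
    exact ⟨Quot.mk R x, rfl⟩

theorem Nat.card_quot_of_adjoin_unrelated {V : Type*} [Finite V] {R R' : V → V → Prop} {u v : V}
    (h : ∀ x y, R' x y ↔ R x y ∨ (x = u ∧ y = v) ∨ (x = v ∧ y = u))
    (huv : Quot.mk R u ≠ Quot.mk R v) : Nat.card (Quot R') + 1 = Nat.card (Quot R) := by
  classical
  -- Redirecting the class of `v` to that of `u` embeds `Quot R'` in `Quot R`, missing only the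
  -- class of `v`.
  let φ : V → Quot R := fun x => if Quot.mk R x = Quot.mk R v then Quot.mk R u else Quot.mk R x
  have hle : ∀ x y, R x y → R' x y := fun x y hxy => (h x y).2 (Or.inl hxy)
  have hφ : ∀ x y, R' x y → φ x = φ y := by
    intro x y hxy
    rcases (h x y).1 hxy with h2 | ⟨rfl, rfl⟩ | ⟨rfl, rfl⟩
    · simp only [φ, Quot.sound h2]
    · simp [φ]
    · simp [φ]
  have huv' : Quot.mk R' u = Quot.mk R' v := Quot.sound ((h u v).2 (Or.inr (Or.inl ⟨rfl, rfl⟩)))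
  have hinj : Function.Injective (Quot.lift φ hφ) := by
    rintro ⟨x⟩ ⟨y⟩ hxy
    have hxy : φ x = φ y := hxy
    simp only [φ] at hxy
    split_ifs at hxy with h1 h2 h2
    · exact Quot.mk_eq_of_le hle (h1.trans h2.symm)
    · exact (Quot.mk_eq_of_le hle h1).trans (huv'.symm.trans (Quot.mk_eq_of_le hle hxy))
    · exact (Quot.mk_eq_of_le hle hxy).trans (huv'.trans (Quot.mk_eq_of_le hle h2).symm)
    · exact Quot.mk_eq_of_le hle hxy
  have hrange : Set.range (Quot.lift φ hφ) = {Quot.mk R v}ᶜ := by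
    ext q
    rw [Set.mem_compl_singleton_iff]
    constructor
    · rintro ⟨⟨x⟩, rfl⟩
      change φ x ≠ _
      simp only [φ]
      split_ifs with h1
      · exact huv
      · exact h1
    · induction q using Quot.ind with
      | mk x =>
        intro hx
        exact ⟨Quot.mk R' x, by change φ x = _; simp [φ, hx]⟩
  rw [← Nat.card_range_of_injective hinj, hrange, Nat.card_coe_set_eq, ← Set.ncard_univ,
    Set.compl_eq_univ_sdiff, Set.ncard_sdiff_singleton_add_one (Set.mem_univ _)]

/-! ### The graphic rank is a matroid rank and detects connectedness. -/

namespace Graph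

variable {α β : Type*} {G : Graph α β}

/-- The adjacency relation of `(V, A)` on the vertex set. -/
def spanningAdj (G : Graph α β) (A : Set β) (u v : G.vertexSet) : Prop :=
  (G.restrict A).Adj u v

theorem numComponents_restrict (G : Graph α β) (A : Set β) :
    (G.restrict A).numComponents = Nat.card (Quot (G.spanningAdj A)) := rfl

theorem spanningAdj_mono {A B : Set β} (h : A ⊆ B) (u v : G.vertexSet)
    (huv : G.spanningAdj A u v) : G.spanningAdj B u v := by
  obtain ⟨e, he, hl⟩ := huv
  exact ⟨e, h he, hl⟩

theorem spanningAdj_insert {e : β} {u v : G.vertexSet} (he : G.IsLink e u v) (A : Set β)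
    (x y : G.vertexSet) :
    G.spanningAdj (insert e A) x y ↔
      G.spanningAdj A x y ∨ (x = u ∧ y = v) ∨ (x = v ∧ y = u) := by
  constructor
  · rintro ⟨f, hf, hl⟩
    rcases hf with rfl | hf
    · rcases he.isLink_iff.1 hl with ⟨h1, h2⟩ | ⟨h1, h2⟩
      · exact Or.inr (Or.inl ⟨Subtype.ext h1.symm, Subtype.ext h2.symm⟩)
      · exact Or.inr (Or.inr ⟨Subtype.ext h2.symm, Subtype.ext h1.symm⟩)
    · exact Or.inl ⟨f, hf, hl⟩
  · rintro (⟨f, hf, hl⟩ | ⟨rfl, rfl⟩ | ⟨rfl, rfl⟩)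
    · exact ⟨f, Or.inr hf, hl⟩
    · exact ⟨e, Or.inl rfl, he⟩
    · exact ⟨e, Or.inl rfl, he.symm⟩

theorem restrict_insert_of_notMem {e : β} (he : e ∉ G.edgeSet) (A : Set β) :
    G.restrict (insert e A) = G.restrict A := by
  rw [← restrict_edgeSet_inter, Set.inter_insert_of_notMem he, restrict_edgeSet_inter]

theorem exists_isLink_vertexSet {e : β} (he : e ∈ G.edgeSet) :
    ∃ u v : G.vertexSet, G.IsLink e u v := by
  obtain ⟨x, y, h⟩ := exists_isLink_of_mem_edgeSet he
  exact ⟨⟨x, h.left_mem⟩, ⟨y, h.right_mem⟩, h⟩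

theorem edgeRank_add_numComponents (hV : G.vertexSet.Finite) (A : Set β) :
    G.edgeRank A + (G.restrict A).numComponents = G.vertexSet.ncard := by
  have := hV.to_subtype
  refine Nat.sub_add_cancel ?_
  rw [numComponents_restrict, ← Nat.card_coe_set_eq]
  exact Nat.card_le_card_of_surjective _ Quot.mk_surjective

theorem edgeRank_insert_of_related {e : β} {u v : G.vertexSet} (he : G.IsLink e u v) {A : Set β}
    (h : Quot.mk (G.spanningAdj A) u = Quot.mk (G.spanningAdj A) v) :
    G.edgeRank (insert e A) = G.edgeRank A := by
  rw [edgeRank, edgeRank, numComponents_restrict, numComponents_restrict,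
    Nat.card_quot_of_adjoin_related (spanningAdj_insert he A) h]

theorem edgeRank_insert_of_unrelated (hV : G.vertexSet.Finite) {e : β} {u v : G.vertexSet}
    (he : G.IsLink e u v) {A : Set β}
    (h : Quot.mk (G.spanningAdj A) u ≠ Quot.mk (G.spanningAdj A) v) :
    G.edgeRank (insert e A) = G.edgeRank A + 1 := by
  have := hV.to_subtype
  have h1 := Nat.card_quot_of_adjoin_unrelated (spanningAdj_insert he A) h
  have h2 := edgeRank_add_numComponents hV A
  have h3 := edgeRank_add_numComponents hV (insert e A)
  rw [numComponents_restrict] at h2 h3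
  omega

theorem edgeRank_insert_eq_iff (hV : G.vertexSet.Finite) {e : β} {u v : G.vertexSet}
    (he : G.IsLink e u v) {A : Set β} :
    G.edgeRank (insert e A) = G.edgeRank A ↔
      Quot.mk (G.spanningAdj A) u = Quot.mk (G.spanningAdj A) v := by
  refine ⟨fun h => ?_, edgeRank_insert_of_related he⟩
  by_contra h1
  have := edgeRank_insert_of_unrelated hV he h1
  omega

theorem edgeRank_insert_cases (hV : G.vertexSet.Finite) (e : β) (A : Set β) :
    G.edgeRank (insert e A) = G.edgeRank A ∨ G.edgeRank (insert e A) = G.edgeRank A + 1 := by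
  by_cases he : e ∈ G.edgeSet
  · obtain ⟨u, v, h⟩ := exists_isLink_vertexSet he
    by_cases h1 : Quot.mk (G.spanningAdj A) u = Quot.mk (G.spanningAdj A) v
    · exact Or.inl (edgeRank_insert_of_related h h1)
    · exact Or.inr (edgeRank_insert_of_unrelated hV h h1)
  · left
    rw [edgeRank, edgeRank, restrict_insert_of_notMem he]

theorem spanningAdj_empty (u v : G.vertexSet) : ¬ G.spanningAdj ∅ u v := by
  rintro ⟨e, he, -⟩
  exact he

theorem mk_spanningAdj_empty_inj {u v : G.vertexSet}
    (h : Quot.mk (G.spanningAdj ∅) u = Quot.mk (G.spanningAdj ∅) v) : u = v := by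
  have h1 := Quot.eqvGen_exact h
  clear h
  induction h1 with
  | rel x y h => exact absurd h (spanningAdj_empty x y)
  | refl => rfl
  | symm x y _ ih => exact ih.symm
  | trans x y z _ _ ih1 ih2 => exact ih1.trans ih2

theorem edgeRank_empty (G : Graph α β) : G.edgeRank ∅ = 0 := by
  rw [edgeRank, numComponents_restrict, ← Nat.card_coe_set_eq,
    Nat.card_congr (Equiv.ofBijective (Quot.mk (G.spanningAdj ∅))
      ⟨fun _ _ => mk_spanningAdj_empty_inj, Quot.mk_surjective⟩), Nat.sub_self]

theorem isMatroidRank_edgeRank [DecidableEq β] (hV : G.vertexSet.Finite) :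
    IsMatroidRank fun A : Finset β => G.edgeRank (A : Set β) where
  empty := by simp [edgeRank_empty]
  le_insert e A := by
    rw [Finset.coe_insert]
    rcases edgeRank_insert_cases hV e (A : Set β) with h | h <;> omega
  insert_le e A := by
    rw [Finset.coe_insert]
    rcases edgeRank_insert_cases hV e (A : Set β) with h | h <;> omega
  insert_eq_of_subset e A B hAB h := by
    rw [Finset.coe_insert] at h ⊢
    by_cases he : e ∈ G.edgeSet
    · obtain ⟨u, v, hl⟩ := exists_isLink_vertexSet he
      rw [edgeRank_insert_eq_iff hV hl] at h ⊢
      exact Quot.mk_eq_of_le (spanningAdj_mono (Finset.coe_subset.2 hAB)) h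
    · rw [edgeRank, edgeRank, restrict_insert_of_notMem he]

theorem exists_isLink_of_edgeRank_singleton_ne_zero {e : β}
    (h : G.edgeRank {e} ≠ 0) : ∃ u v : G.vertexSet, u ≠ v ∧ G.IsLink e u v := by
  by_cases he : e ∈ G.edgeSet
  · obtain ⟨u, v, hl⟩ := exists_isLink_vertexSet he
    refine ⟨u, v, ?_, hl⟩
    rintro rfl
    rw [← insert_empty_eq, edgeRank_insert_of_related hl rfl, edgeRank_empty] at h
    exact h rfl
  · rw [← insert_empty_eq, edgeRank, restrict_insert_of_notMem he] at h
    exact absurd (edgeRank_empty G) h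

theorem edgeRank_pair_ne_of_noParallelEdges (hV : G.vertexSet.Finite) (hG : G.NoParallelEdges)
    {e f : β} (hef : e ≠ f) (hf : G.edgeRank {f} ≠ 0) :
    G.edgeRank {e, f} ≠ G.edgeRank {e} := by
  obtain ⟨a, b, hab, hlf⟩ := exists_isLink_of_edgeRank_singleton_ne_zero hf
  rw [Set.pair_comm]
  intro h
  rw [edgeRank_insert_eq_iff hV hlf] at h
  have key : ∀ x y : G.vertexSet, Relation.EqvGen (G.spanningAdj {e}) x y →
      x = y ∨ G.IsLink e x y := by
    intro x y hxy
    induction hxy with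
    | rel x y hxy =>
      obtain ⟨g, hg, hl⟩ := hxy
      exact Or.inr (Set.mem_singleton_iff.1 hg ▸ hl)
    | refl => exact Or.inl rfl
    | symm x y _ ih => exact ih.imp Eq.symm IsLink.symm
    | trans x y z _ _ ih1 ih2 =>
      rcases ih1 with rfl | h1
      · exact ih2
      · rcases ih2 with rfl | h2
        · exact Or.inr h1
        · exact Or.inl (Subtype.ext (h1.left_unique h2.symm))
  rcases key a b (Quot.eqvGen_exact h) with h1 | h1
  · exact hab h1
  · exact hef (hG e f a b (fun h => hab (Subtype.ext h)) h1 hlf)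

theorem mk_spanningAdj_eq_iff (A : Set β) (u v : G.vertexSet) :
    Quot.mk (G.spanningAdj A) u = Quot.mk (G.spanningAdj A) v ↔
      Relation.ReflTransGen (G.restrict A).Adj u v := by
  constructor
  · intro h
    have h1 := Quot.eqvGen_exact h
    clear h
    induction h1 with
    | rel x y h => exact Relation.ReflTransGen.single h
    | refl => exact Relation.ReflTransGen.refl
    | symm x y _ ih =>
      have : Std.Symm (G.restrict A).Adj := ⟨fun _ _ h => h.symm⟩
      exact Std.Symm.symm _ _ ih
    | trans x y z _ _ ih1 ih2 => exact ih1.trans ih2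
  · have key : ∀ y : α, Relation.ReflTransGen (G.restrict A).Adj u y → ∃ hy : y ∈ G.vertexSet,
        Quot.mk (G.spanningAdj A) u = Quot.mk (G.spanningAdj A) ⟨y, hy⟩ := by
      intro y hy
      induction hy with
      | refl => exact ⟨u.2, rfl⟩
      | tail _ h ih =>
        obtain ⟨hy, h1⟩ := ih
        exact ⟨h.right_mem, h1.trans (Quot.sound h)⟩
    intro h
    exact (key v h).2

theorem isConnected_restrict_iff (hV : G.vertexSet.Nonempty) (A : Set β) :
    (G.restrict A).IsConnected ↔ (G.restrict A).numComponents = 1 := by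
  rw [numComponents_restrict, Nat.card_eq_one_iff_unique]
  constructor
  · rintro ⟨-, h⟩
    refine ⟨⟨?_⟩, ⟨Quot.mk _ ⟨_, hV.some_mem⟩⟩⟩
    rintro ⟨u⟩ ⟨v⟩
    exact (mk_spanningAdj_eq_iff A u v).2 (h u u.2 v v.2)
  · rintro ⟨h, -⟩
    exact ⟨hV, fun u hu v hv => 
      (mk_spanningAdj_eq_iff (G := G) A ⟨u, hu⟩ ⟨v, hv⟩).1 (Subsingleton.elim _ _)⟩

theorem isConnected_restrict_iff_edgeRank (hVfin : G.vertexSet.Finite)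
    (hV : G.vertexSet.Nonempty) (A : Set β) :
    (G.restrict A).IsConnected ↔ G.edgeRank A + 1 = G.vertexSet.ncard := by
  rw [isConnected_restrict_iff hV, ← edgeRank_add_numComponents hVfin A]
  omega

theorem isConnected_iff_edgeRank (hVfin : G.vertexSet.Finite) (hV : G.vertexSet.Nonempty) :
    G.IsConnected ↔ G.edgeRank G.edgeSet + 1 = G.vertexSet.ncard := by
  rw [← isConnected_restrict_iff_edgeRank hVfin hV, restrict_self]

theorem edgeRank_lt_ncard (hVfin : G.vertexSet.Finite) (hV : G.vertexSet.Nonempty) (A : Set β) :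
    G.edgeRank A < G.vertexSet.ncard := by
  have h1 := edgeRank_add_numComponents hVfin A
  have := hVfin.to_subtype
  have : 0 < (G.restrict A).numComponents := by
    rw [numComponents_restrict]
    have : Nonempty (Quot (G.spanningAdj A)) := ⟨Quot.mk _ ⟨_, hV.some_mem⟩⟩
    exact Nat.card_pos
  omega

end Graph

/-! ### Coefficient reversal and comparison with `(1 - X) ^ (-r)`. -/

theorem coeff_X_pow_mul_one_sub_X_pow_eq (a b s : ℕ) (hs : s ≤ a + b) :
    ((X - 1 : ℤ[X]) ^ a).coeff (a + b - s) = (X ^ b * (1 - X) ^ a : ℤ[X]).coeff s := by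
  have h : ∀ a : ℕ, reflect a ((X - 1 : ℤ[X]) ^ a) = (1 - X) ^ a := by
    intro a
    induction a with
    | zero => simp
    | succ a ih =>
      have h1 : (X - 1 : ℤ[X]).natDegree ≤ 1 := by simpa using (natDegree_X_sub_C (1 : ℤ)).le
      have h2 : ((X - 1 : ℤ[X]) ^ a).natDegree ≤ a := by
        simpa using natDegree_pow_le_of_le a h1
      rw [pow_succ, reflect_mul _ _ h2 h1, ih, reflect_sub, reflect_one_X, pow_succ]
      congr 2
      simp
  rw [← h, coeff_X_pow_mul']
  split_ifs with hb
  · rw [coeff_reflect, revAt_le (by omega)]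
    congr 1
    omega
  · refine coeff_eq_zero_of_natDegree_lt ?_
    have h1 : (X - 1 : ℤ[X]).natDegree ≤ 1 := by simpa using (natDegree_X_sub_C (1 : ℤ)).le
    have h2 : ((X - 1 : ℤ[X]) ^ a).natDegree ≤ a := by
      simpa using natDegree_pow_le_of_le a h1
    omega

theorem one_sub_X_pow_mul_dualHPoly {β : Type*} [DecidableEq β] {r : Finset β → ℕ}
    (hr : IsMatroidRank r) (E : Finset β) :
    (1 - X) ^ r E * dualHPoly r E = 1 - ∑ A ∈ E.powerset,
      if r A ≠ r E then X ^ (E.card - A.card) * (1 - X) ^ A.card else 0 := by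
  have h : (1 : ℤ[X]) = ∑ A ∈ E.powerset, (1 - X) ^ A.card * X ^ (E.card - A.card) := by
    rw [Finset.sum_pow_mul_eq_add_pow, sub_add_cancel, one_pow]
  rw [eq_sub_iff_add_eq]
  conv_rhs => rw [h]
  rw [dualHPoly, Finset.mul_sum, ← Finset.sum_add_distrib]
  refine Finset.sum_congr rfl fun A _ => ?_
  by_cases h1 : r A = r E
  · have h2 : A.card = r E + (A.card - r E) := by
      have := hr.le_card A
      omega
    rw [if_pos h1, if_neg (not_not.2 h1)]
    conv_rhs => rw [h2, pow_add, ← h2]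
    ring
  · rw [if_neg h1, if_pos h1]
    ring

theorem X_pow_dvd_sum_X_pow_mul_one_sub_X_pow_iff {ι : Type*} (s : Finset ι) (b a : ι → ℕ)
    (k : ℕ) : (X : ℤ[X]) ^ k ∣ ∑ i ∈ s, X ^ b i * (1 - X) ^ a i ↔ ∀ i ∈ s, k ≤ b i := by
  constructor
  · intro h
    by_contra! hcon
    obtain ⟨i₀, hi₀, hlt⟩ := hcon
    -- At the least exponent every term contributes `0` or `1`, so nothing cancels.
    obtain ⟨i, hi, hmin⟩ := s.exists_min_image b ⟨i₀, hi₀⟩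
    have h1 := X_pow_dvd_iff.1 h (b i) ((hmin i₀ hi₀).trans_lt hlt)
    rw [finsetSum_coeff] at h1
    have h2 : ∀ j ∈ s, 0 ≤ (X ^ b j * (1 - X) ^ a j : ℤ[X]).coeff (b i) ∧
        (b j = b i → 0 < (X ^ b j * (1 - X) ^ a j : ℤ[X]).coeff (b i)) := by
      intro j hj
      have h3 : ((1 - X : ℤ[X]) ^ a j).coeff 0 = 1 := by simp [coeff_zero_eq_eval_zero]
      rw [coeff_X_pow_mul']
      rcases (hmin j hj).eq_or_lt with h4 | h4
      · rw [h4]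
        simp [h3]
      · rw [if_neg (by omega)]
        exact ⟨le_rfl, fun h => by omega⟩
    have h3 := Finset.sum_pos' (fun j hj => (h2 j hj).1) ⟨i, hi, (h2 i hi).2 rfl⟩
    omega
  · intro h
    exact Finset.dvd_sum fun i hi => (pow_dvd_pow X (h i hi)).mul_right _

theorem coeff_dualHPoly_eq_coeff_invOneSubPow_iff {β : Type*} [DecidableEq β]
    {r : Finset β → ℕ} (hr : IsMatroidRank r) (E : Finset β) (k : ℕ) :
    (∀ j < k, (dualHPoly r E).coeff j =
        PowerSeries.coeff j (PowerSeries.invOneSubPow ℤ (r E)).val) ↔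
      ∀ A ⊆ E, r A ≠ r E → k ≤ E.card - A.card := by
  have h1 : (PowerSeries.invOneSubPow ℤ (r E)).val * (1 - PowerSeries.X) ^ r E = 1 := by
    rw [← PowerSeries.invOneSubPow_inv_eq_one_sub_pow]
    exact Units.mul_inv _
  set N : ℤ[X] := ∑ A ∈ E.powerset,
      if r A ≠ r E then X ^ (E.card - A.card) * (1 - X) ^ A.card else 0 with hN
  have h2 : (PowerSeries.invOneSubPow ℤ (r E)).val - (dualHPoly r E : PowerSeries ℤ) =
      (PowerSeries.invOneSubPow ℤ (r E)).val * (N : PowerSeries ℤ) := by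
    have h3 := congrArg (fun p : ℤ[X] => (p : PowerSeries ℤ)) (one_sub_X_pow_mul_dualHPoly hr E)
    simp only [Polynomial.coe_mul, Polynomial.coe_pow, Polynomial.coe_sub, Polynomial.coe_one,
      Polynomial.coe_X] at h3
    rw [← hN] at h3
    linear_combination (dualHPoly r E : PowerSeries ℤ) * h1 -
      (PowerSeries.invOneSubPow ℤ (r E)).val * h3
  have h4 : (∀ j < k, (dualHPoly r E).coeff j =
        PowerSeries.coeff j (PowerSeries.invOneSubPow ℤ (r E)).val) ↔
      PowerSeries.X ^ k ∣ (N : PowerSeries ℤ) := by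
    rw [← Units.dvd_mul_left (u := PowerSeries.invOneSubPow ℤ (r E)), ← h2,
      PowerSeries.X_pow_dvd_iff]
    refine forall₂_congr fun j _ => ?_
    rw [map_sub, Polynomial.coeff_coe, sub_eq_zero, eq_comm]
  have h5 : PowerSeries.X ^ k ∣ (N : PowerSeries ℤ) ↔ X ^ k ∣ N := by
    rw [PowerSeries.X_pow_dvd_iff, Polynomial.X_pow_dvd_iff]
    simp only [Polynomial.coeff_coe]
  rw [h4, h5, hN, ← Finset.sum_filter, X_pow_dvd_sum_X_pow_mul_one_sub_X_pow_iff]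
  simp only [Finset.mem_filter, Finset.mem_powerset, and_imp]

theorem Int.choose_eq_coeff_invOneSubPow (n j : ℕ) (hn : 0 < n) :
    Ring.choose ((n : ℤ) - 2 + j) j =
      PowerSeries.coeff j (PowerSeries.invOneSubPow ℤ (n - 1)).val := by
  obtain ⟨d, rfl⟩ := Nat.exists_eq_succ_of_ne_zero hn.ne'
  cases d with
  -- A single vertex: the upper entry is `j - 1`, equal to `-1` for `j = 0`, and the series is `1`.
  | zero =>
    cases j with
    | zero => simp [PowerSeries.invOneSubPow_zero]
    | succ j =>
      have : ((Nat.succ 0 : ℕ) : ℤ) - 2 + ((j + 1 : ℕ) : ℤ) = (j : ℕ) := by push_cast; ring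
      rw [this, Ring.choose_natCast]
      simp [PowerSeries.invOneSubPow_zero, PowerSeries.coeff_one]
  | succ d =>
    have : ((Nat.succ (d + 1) : ℕ) : ℤ) - 2 + (j : ℤ) = (d + j : ℕ) := by push_cast; ring
    rw [this, Ring.choose_natCast, Nat.succ_sub_one,
      PowerSeries.invOneSubPow_val_succ_eq_mk_add_choose, PowerSeries.coeff_mk, Nat.choose_symm_add]

/-! ### Translation to the Tutte polynomial, and the two connectivity cases. -/

namespace Graph

variable {α β : Type*} {G : Graph α β}

theorem tutteAtOne_eq_sum [DecidableEq β] (hV : G.vertexSet.Finite) {E : Finset β}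
    (hE : (E : Set β) = G.edgeSet) :
    G.tutteAtOne = ∑ A ∈ E.powerset,
      if G.edgeRank (A : Set β) = G.edgeRank (E : Set β) then
        (X - 1) ^ (A.card - G.edgeRank (E : Set β)) else 0 := by
  have hr := isMatroidRank_edgeRank (β := β) hV
  have h1 : G.edgeSet.powerset = (fun A : Finset β => (A : Set β)) '' (E.powerset : Set _) := by
    ext A
    simp only [Set.mem_powerset_iff, Set.mem_image, Finset.mem_coe, Finset.mem_powerset]
    constructor
    · intro h
      have hA : A.Finite := (E.finite_toSet).subset (hE ▸ h)
      refine ⟨hA.toFinset, ?_, by simp⟩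
      rw [← Finset.coe_subset]
      simpa [hE] using h
    · rintro ⟨B, hB, rfl⟩
      rw [← hE]
      exact Finset.coe_subset.2 hB
  rw [tutteAtOne, tuttePolynomial, h1,
    finsum_mem_image (fun A _ B _ h => Finset.coe_injective h), finsum_mem_coe_finset,
    Polynomial.map_sum]
  refine Finset.sum_congr rfl fun A hA => ?_
  have h2 : G.edgeRank (A : Set β) ≤ G.edgeRank (E : Set β) := hr.mono (Finset.mem_powerset.1 hA)
  rw [← hE, Set.ncard_coe_finset]
  simp only [Polynomial.map_mul, Polynomial.map_pow, Polynomial.map_sub, Polynomial.map_one,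
    map_X, map_C, coe_evalRingHom, eval_X]
  split_ifs with h3
  · rw [h3, Nat.sub_self, pow_zero, one_mul]
  · rw [C_1, sub_self, zero_pow (by omega), zero_mul]

theorem intCoeff_tutteAtOne [DecidableEq β] (hV : G.vertexSet.Finite) {E : Finset β}
    (hE : (E : Set β) = G.edgeSet) (s : ℕ) :
    intCoeff G.tutteAtOne ((E.card : ℤ) - G.edgeRank (E : Set β) - s) =
      (dualHPoly (fun A : Finset β => G.edgeRank (A : Set β)) E).coeff s := by
  have hr := isMatroidRank_edgeRank (β := β) hV
  have hrE : G.edgeRank (E : Set β) ≤ E.card := hr.le_card E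
  rw [intCoeff]
  split_ifs with h
  · have h1 : ((E.card : ℤ) - G.edgeRank (E : Set β) - s).toNat =
        E.card - G.edgeRank (E : Set β) - s := by omega
    rw [h1, tutteAtOne_eq_sum hV hE, dualHPoly, finsetSum_coeff, finsetSum_coeff]
    refine Finset.sum_congr rfl fun A hA => ?_
    have h2 := Finset.card_le_card (Finset.mem_powerset.1 hA)
    have h3 : G.edgeRank (A : Set β) ≤ A.card := hr.le_card A
    split_ifs with h4
    · rw [← coeff_X_pow_mul_one_sub_X_pow_eq _ _ _ (by omega)]
      congr 1
      omega
    · simp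
  -- A negative index means `s > |E| - r(E)`, which is beyond the degree.
  · refine (coeff_dualHPoly_eq_zero hr ?_).symm
    have := Finset.card_filter_le E fun e => G.edgeRank (({e} : Finset β) : Set β) ≠ 0
    rw [looplessNullity]
    omega

theorem not_coeff_dualHPoly_of_not_isConnected [DecidableEq β] (hVfin : G.vertexSet.Finite)
    (hV : G.vertexSet.Nonempty) {E : Finset β} (hE : (E : Set β) = G.edgeSet)
    (hG : ¬ G.IsConnected) {k : ℕ} (hk0 : 0 < k) (hk : k = 1 → G.NoParallelEdges) :
    ∃ j < k, (dualHPoly (fun A : Finset β => G.edgeRank (A : Set β)) E).coeff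
      (j + (G.vertexSet.ncard - 1 - G.edgeRank (E : Set β))) ≠
        Ring.choose ((G.vertexSet.ncard : ℤ) - 2 + j) j := by
  have hr := isMatroidRank_edgeRank (β := β) hVfin
  have h1 := edgeRank_lt_ncard hVfin hV (E : Set β)
  rw [isConnected_iff_edgeRank hVfin hV, ← hE] at hG
  obtain ⟨c, hc⟩ : ∃ c, G.vertexSet.ncard - 1 - G.edgeRank (E : Set β) = c + 1 :=
    ⟨G.vertexSet.ncard - 1 - G.edgeRank (E : Set β) - 1, by omega⟩
  rw [hc]
  by_contra! hcon
  have h2 := hcon 0 hk0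
  rw [Ring.choose_zero_right, zero_add] at h2
  rcases (show k = 1 ∨ 1 < k by omega) with h3 | h3
  · refine coeff_dualHPoly_ne_one_of_simple hr (fun e _ f _ hef _ hf => ?_) c h2
    rw [Finset.coe_singleton] at hf
    rw [Finset.coe_pair, Finset.coe_singleton]
    exact edgeRank_pair_ne_of_noParallelEdges hVfin (hk h3) hef hf
  · have h4 := hcon 1 h3
    have h5 := coeff_dualHPoly_succ_le_one hr h2
    rw [Ring.choose_one_right, show 1 + (c + 1) = c + 2 by ring] at h4
    rw [h4] at h5
    -- `h5` gives `|V| ≤ 2`, while disconnectedness gives `r(E) < |V| - 1`.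
    have h6 : G.edgeRank (E : Set β) = 0 := by
      push_cast at h5
      omega
    have h7 : looplessNullity (fun A : Finset β => G.edgeRank (A : Set β)) E = 0 := by
      rw [looplessNullity, Finset.filter_false_of_mem]
      · simp
      · intro e he
        have : G.edgeRank (({e} : Finset β) : Set β) ≤ G.edgeRank (E : Set β) :=
          hr.mono (Finset.singleton_subset_iff.2 he)
        omega
    rw [coeff_dualHPoly_eq_zero hr (by omega)] at h2
    omega

theorem isEdgeConnected_iff_edgeRank [DecidableEq β] (hVfin : G.vertexSet.Finite)
    (hV : G.vertexSet.Nonempty) {E : Finset β} (hE : (E : Set β) = G.edgeSet)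
    (hG : G.IsConnected) (k : ℕ) :
    G.IsEdgeConnected k ↔
      ∀ A ⊆ E, G.edgeRank (A : Set β) ≠ G.edgeRank (E : Set β) → k ≤ E.card - A.card := by
  rw [isConnected_iff_edgeRank hVfin hV, ← hE] at hG
  constructor
  · intro h A hA hne
    by_contra! hlt
    have h1 := h (E \ A : Finset β) (by rw [← hE]; exact Finset.coe_subset.2 Finset.sdiff_subset)
      (by
        rw [Set.encard_coe_eq_coe_finsetCard, Finset.card_sdiff_of_subset hA]
        exact_mod_cast hlt)
    rw [← restrict_edgeSet_sdiff_eq_deleteEdges, isConnected_restrict_iff_edgeRank hVfin hV,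
      ← hE, ← Finset.coe_sdiff, Finset.sdiff_sdiff_eq_self hA] at h1
    omega
  · intro h F hF hlt
    have hFfin : F.Finite := E.finite_toSet.subset (hE ▸ hF)
    lift F to Finset β using hFfin
    rw [← hE, Finset.coe_subset] at hF
    rw [Set.encard_coe_eq_coe_finsetCard, Nat.cast_lt] at hlt
    rw [← restrict_edgeSet_sdiff_eq_deleteEdges, isConnected_restrict_iff_edgeRank hVfin hV,
      ← hE, ← Finset.coe_sdiff]
    by_contra hne
    have h1 := h (E \ F) Finset.sdiff_subset (by omega)
    have h2 := Finset.card_le_card hF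
    rw [Finset.card_sdiff_of_subset hF] at h1
    omega

end Graph

theorem mainTheorem11 {α β : Type*} (G : Graph α β)
    (hVfin : G.vertexSet.Finite) (hEfin : G.edgeSet.Finite) (hV : G.vertexSet.Nonempty)
    (k : ℕ) (hk : k = 1 → G.IsConnected ∨ G.NoParallelEdges) :
    (∀ i : ℤ,
        (G.edgeSet.ncard : ℤ) - (G.vertexSet.ncard : ℤ) + 2 - (k : ℤ) ≤ i →
        i ≤ (G.edgeSet.ncard : ℤ) - (G.vertexSet.ncard : ℤ) + 1 →
        intCoeff G.tutteAtOne i =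
          Ring.choose ((G.edgeSet.ncard : ℤ) - i - 1)
            ((G.edgeSet.ncard : ℤ) - (G.vertexSet.ncard : ℤ) + 1 - i).toNat) ↔
      G.IsEdgeConnected k := by
  classical
  obtain ⟨E, hE⟩ : ∃ E : Finset β, (E : Set β) = G.edgeSet := ⟨hEfin.toFinset, by simp⟩
  have hr := Graph.isMatroidRank_edgeRank (β := β) hVfin
  have hlt := Graph.edgeRank_lt_ncard hVfin hV (E : Set β)
  have hcard : G.edgeSet.ncard = E.card := by rw [← hE, Set.ncard_coe_finset]
  -- Substitute `i = |E| - |V| + 1 - j`; the shift `|V| - 1 - r(E)` is the number of components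
  -- minus one.
  have key : (∀ i : ℤ,
        (G.edgeSet.ncard : ℤ) - (G.vertexSet.ncard : ℤ) + 2 - (k : ℤ) ≤ i →
        i ≤ (G.edgeSet.ncard : ℤ) - (G.vertexSet.ncard : ℤ) + 1 →
        intCoeff G.tutteAtOne i =
          Ring.choose ((G.edgeSet.ncard : ℤ) - i - 1)
            ((G.edgeSet.ncard : ℤ) - (G.vertexSet.ncard : ℤ) + 1 - i).toNat) ↔
      ∀ j < k, (dualHPoly (fun A : Finset β => G.edgeRank (A : Set β)) E).coeff
        (j + (G.vertexSet.ncard - 1 - G.edgeRank (E : Set β))) =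
          Ring.choose ((G.vertexSet.ncard : ℤ) - 2 + j) j := by
    rw [hcard]
    constructor
    · intro h j hj
      have h1 := h ((E.card : ℤ) - (G.vertexSet.ncard : ℤ) + 1 - j) (by omega) (by omega)
      rw [← Graph.intCoeff_tutteAtOne hVfin hE]
      convert h1 using 2 <;> omega
    · intro h i hi1 hi2
      obtain ⟨j, rfl⟩ : ∃ j : ℕ, i = (E.card : ℤ) - (G.vertexSet.ncard : ℤ) + 1 - j :=
        ⟨((E.card : ℤ) - (G.vertexSet.ncard : ℤ) + 1 - i).toNat, by omega⟩
      have h1 := h j (by omega)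
      rw [← Graph.intCoeff_tutteAtOne hVfin hE] at h1
      convert h1 using 2 <;> omega
  rw [key]
  by_cases hG : G.IsConnected
  · rw [Graph.isEdgeConnected_iff_edgeRank hVfin hV hE hG]
    rw [Graph.isConnected_iff_edgeRank hVfin hV, ← hE] at hG
    refine Iff.trans ?_ (coeff_dualHPoly_eq_coeff_invOneSubPow_iff hr E k)
    refine forall₂_congr fun j _ => ?_
    rw [Int.choose_eq_coeff_invOneSubPow _ _ (by omega), ← hG]
    simp
  · rcases Nat.eq_zero_or_pos k with rfl | hk0
    · exact ⟨fun _ F _ hF => absurd hF (by simp), fun _ j hj => absurd hj (by omega)⟩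
    · refine iff_of_false (fun h => ?_) fun h => hG ?_
      · obtain ⟨j, hj, hne⟩ := Graph.not_coeff_dualHPoly_of_not_isConnected hVfin hV hE hG hk0
          fun h => (hk h).resolve_left hG
        exact hne (h j hj)
      · have := h ∅ (Set.empty_subset _) (by simpa using hk0)
        rwa [Graph.deleteEdges_empty] at this
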